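/- For each $n\ge 1$ consider $n$ actors with assigned treatments $c_{n,1},\dots,c_{n,n}\in\{A,B\}$ (random or deterministic) and treatments actually received $d_{n,1},\dots,d_{n,n}\in\{A,B\}$, defined on a probability space that may depend on $n$. Suppose interference follows Bernoulli switching: for every $n$ the events $\{d_{n,i}\neq c_{n,i}\}$, $i=1,\dots,n$, are independent and have probabilities $p_i=p_{n,i}\in[0,1]$ (which may, but need not, depend on $n$). Let $n_S=\sum_{i=1}^n \mathbb{I}(c_{n,i}=d_{n,i})$ be the number of actors who receive the assigned treatment, let $n_D=n-n_S$ be the number of those who receive the opposite one, and put $$s_n=\Big(\sum_{i=1}^n p_i(1-p_i)\Big)^{1/2},\qquad \mu_{\mathbf p}=n-2\sum_{i=1}^n p_i .$$ If $s_n\to\infty$ as $n\to\infty$, then $$\frac{n_S-n_D-\mu_{\mathbf p}}{2s_n}\;\xrightarrow{D}\;N(0,1)\qquad (n\to\infty).$$ -/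

import Mathlib

open MeasureTheory ProbabilityTheory Filter

/-- The two treatments (class labels) of an A/B test. -/
inductive Treatment : Type
  | A
  | B
  deriving DecidableEq

/-- The two-point set of treatments carries the discrete sigma-algebra. -/
instance Treatment.instMeasurableSpace : MeasurableSpace Treatment := ⊤

/-- `n_S`: the number of actors whose received label agrees with the assigned one. -/
def numSame {n : ℕ} (c d : Fin n → Treatment) : ℕ :=
  ∑ j : Fin n, if c j = d j then 1 else 0

/-- `n_D = n - n_S`: the number of actors whose label was changed by interference.
The subtraction never truncates, see `numSame_le`. -/
def numDiff {n : ℕ} (c d : Fin n → Treatment) : ℕ :=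
  n - numSame c d

theorem numSame_le {n : ℕ} (c d : Fin n → Treatment) : numSame c d ≤ n := by
  unfold numSame
  calc ∑ j : Fin n, (if c j = d j then 1 else 0) ≤ ∑ _j : Fin n, 1 :=
        Finset.sum_le_sum fun j _ => by split_ifs <;> simp
    _ = n := by simp

/-- Bernoulli switching for `n` actors: `c` are the assigned labels (random, or deterministic when
`c i` is constant), `d` the labels after interference. The events "actor `i` receives the
treatment opposite to the assigned one" are independent and the `i`-th has probability `p i`. -/
structure IsBernoulliSwitching {Ω : Type*} [MeasurableSpace Ω] (μ : Measure Ω) {n : ℕ}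
    (p : Fin n → ℝ) (c d : Fin n → Ω → Treatment) : Prop where
  measurable_assigned : ∀ i, Measurable (c i)
  measurable_received : ∀ i, Measurable (d i)
  indep : iIndepSet (fun i => {ω | d i ω ≠ c i ω}) μ
  prob : ∀ i, μ.real {ω | d i ω ≠ c i ω} = p i

/-- `s_n`, the nonnegative square root of `∑ p_i (1 - p_i)`. -/
noncomputable def switchingSD {n : ℕ} (p : Fin n → ℝ) : ℝ :=
  Real.sqrt (∑ i, p i * (1 - p i))

/-- `μ_p = n - 2 ∑ p_i`. -/
noncomputable def switchingMean {n : ℕ} (p : Fin n → ℝ) : ℝ :=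
  (n : ℝ) - 2 * ∑ i, p i

/-! The statistic is a sum of independent centred Bernoulli variables divided by `s_n`, so Lévy's
continuity theorem reduces the claim to pointwise convergence of characteristic functions. With `u =
t / s_n`, each factor is within `2 p_i (1 - p_i) |u|^3` of the Gaussian factor of equal variance
(`norm_bernoulli_charFun_sub_exp_le`). The variances sum to `s_n ^ 2`, so the errors total at most
`2 |t|^3 / s_n`, which tends to zero. -/

/-- Replace the factors one at a time; those left untouched have norm at most one. -/
theorem norm_prod_sub_prod_le_sum_norm_sub {ι : Type*} (s : Finset ι) (a b : ι → ℂ)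
    (ha : ∀ i ∈ s, ‖a i‖ ≤ 1) (hb : ∀ i ∈ s, ‖b i‖ ≤ 1) :
    ‖∏ i ∈ s, a i - ∏ i ∈ s, b i‖ ≤ ∑ i ∈ s, ‖a i - b i‖ := by
  classical
  induction s using Finset.induction with
  | empty => simp
  | insert j s hj ih =>
    rw [Finset.prod_insert hj, Finset.prod_insert hj, Finset.sum_insert hj]
    have hprod : ‖∏ i ∈ s, b i‖ ≤ 1 := by
      rw [norm_prod]
      exact Finset.prod_le_one (fun _ _ => norm_nonneg _)
        fun i hi => hb i (Finset.mem_insert_of_mem hi)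
    have hs := ih (fun i hi => ha i (Finset.mem_insert_of_mem hi))
      fun i hi => hb i (Finset.mem_insert_of_mem hi)
    calc ‖a j * ∏ i ∈ s, a i - b j * ∏ i ∈ s, b i‖
        = ‖(a j - b j) * ∏ i ∈ s, b i + a j * (∏ i ∈ s, a i - ∏ i ∈ s, b i)‖ := by
          congr 1; ring
      _ ≤ ‖a j - b j‖ * ‖∏ i ∈ s, b i‖ + ‖a j‖ * ‖∏ i ∈ s, a i - ∏ i ∈ s, b i‖ := by
          rw [← norm_mul, ← norm_mul]; exact norm_add_le _ _
      _ ≤ ‖a j - b j‖ * 1 + 1 * ∑ i ∈ s, ‖a i - b i‖ := by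
          gcongr
          exact ha j (Finset.mem_insert_self j s)
      _ = _ := by ring

theorem norm_cexp_mul_I_sub_taylor_two_le {x : ℝ} (hx : |x| ≤ 1) :
    ‖Complex.exp (x * Complex.I) - (1 + x * Complex.I - x ^ 2 / 2)‖ ≤ |x| ^ 3 := by
  have hnorm : ‖(x * Complex.I : ℂ)‖ = |x| := by simp
  have h := Complex.exp_bound (x := x * Complex.I) (hnorm.trans_le hx) (n := 3) (by norm_num)
  rw [hnorm] at h
  simp only [Finset.sum_range_succ, Finset.sum_range_zero, Nat.factorial, mul_pow,
    Complex.I_sq] at h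
  norm_num at h
  refine le_trans (le_of_eq ?_) (h.trans ?_)
  · congr 1; ring
  -- The exponential bound has constant `4 / (3! * 3) = 2 / 9`, relaxed here to `1`.
  · have := pow_nonneg (abs_nonneg x) 3
    linarith

/-- The characteristic function of a centred Bernoulli variable agrees with that of the Gaussian
of the same variance up to a third-order error proportional to the variance. -/
theorem norm_bernoulli_charFun_sub_exp_le {p u : ℝ} (hp0 : 0 ≤ p) (hp1 : p ≤ 1) (hu : |u| ≤ 1) :
    ‖(p * Complex.exp ((u * (p - 1) : ℝ) * Complex.I)
        + (1 - p) * Complex.exp ((u * p : ℝ) * Complex.I) : ℂ)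
        - Complex.exp ((-(p * (1 - p) * u ^ 2 / 2) : ℝ))‖ ≤ 2 * (p * (1 - p)) * |u| ^ 3 := by
  have hv : 0 ≤ p * (1 - p) := mul_nonneg hp0 (by linarith)
  have hv1 : p * (1 - p) ≤ 1 := by nlinarith
  have hu0 := abs_nonneg u
  have hq : |p - 1| = 1 - p := by rw [abs_of_nonpos (by linarith)]; ring
  have hx : |u * (p - 1)| = |u| * (1 - p) := by rw [abs_mul, hq]
  have hy : |u * p| = |u| * p := by rw [abs_mul, abs_of_nonneg hp0]
  have h1 := norm_cexp_mul_I_sub_taylor_two_le (x := u * (p - 1)) (by rw [hx]; nlinarith)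
  have h2 := norm_cexp_mul_I_sub_taylor_two_le (x := u * p) (by rw [hy]; nlinarith)
  rw [hx] at h1
  rw [hy] at h2
  have hu2 : u ^ 2 ≤ 1 := by rw [← sq_abs]; nlinarith
  have hz : |-(p * (1 - p) * u ^ 2 / 2)| = p * (1 - p) * |u| ^ 2 / 2 := by
    rw [abs_neg, abs_of_nonneg (by positivity), sq_abs]
  have h3 : |Real.exp (-(p * (1 - p) * u ^ 2 / 2)) - 1 - -(p * (1 - p) * u ^ 2 / 2)|
      ≤ p * (1 - p) * |u| ^ 3 := by
    refine (Real.abs_exp_sub_one_sub_id_le ?_).trans ?_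
    · rw [hz, sq_abs]; nlinarith [sq_nonneg u]
    -- Only one factor `p * (1 - p)` of the square is spent on smallness; the other must survive so
    -- that the errors can be summed.
    · rw [← sq_abs, hz]
      calc (p * (1 - p) * |u| ^ 2 / 2) ^ 2
          = p * (1 - p) * |u| ^ 3 * ((p * (1 - p)) * |u| / 4) := by ring
        _ ≤ p * (1 - p) * |u| ^ 3 * 1 := by
          gcongr
          nlinarith
        _ = _ := by ring
  have h3' : ‖Complex.exp ((-(p * (1 - p) * u ^ 2 / 2) : ℝ)) - 1
      - ((-(p * (1 - p) * u ^ 2 / 2) : ℝ) : ℂ)‖ ≤ p * (1 - p) * |u| ^ 3 := by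
    rw [← Complex.ofReal_exp, ← Complex.ofReal_one, ← Complex.ofReal_sub, ← Complex.ofReal_sub,
      Complex.norm_real]
    exact h3
  set e₁ := Complex.exp ((u * (p - 1) : ℝ) * Complex.I)
  set e₂ := Complex.exp ((u * p : ℝ) * Complex.I)
  set e₃ := Complex.exp ((-(p * (1 - p) * u ^ 2 / 2) : ℝ))
  -- The Taylor polynomials cancel: the mean is zero and the second moment is `p * (1 - p)`.
  have hdecomp : (p * e₁ + (1 - p) * e₂ : ℂ) - e₃
      = (p : ℂ) * (e₁ - (1 + (u * (p - 1) : ℝ) * Complex.I - ((u * (p - 1) : ℝ) : ℂ) ^ 2 / 2))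
        + ((1 - p : ℝ) : ℂ) * (e₂ - (1 + (u * p : ℝ) * Complex.I - ((u * p : ℝ) : ℂ) ^ 2 / 2))
        - (e₃ - 1 - ((-(p * (1 - p) * u ^ 2 / 2) : ℝ) : ℂ)) := by
    push_cast; ring
  rw [hdecomp]
  refine (norm_sub_le _ _).trans ((add_le_add (norm_add_le _ _) h3').trans ?_)
  rw [norm_mul, norm_mul, Complex.norm_real, Complex.norm_real, Real.norm_of_nonneg hp0,
    Real.norm_of_nonneg (by linarith : (0 : ℝ) ≤ 1 - p)]
  have h4 := mul_le_mul_of_nonneg_left h1 hp0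
  have h5 := mul_le_mul_of_nonneg_left h2 (by linarith : (0 : ℝ) ≤ 1 - p)
  -- The third absolute moment is at most the variance, since the centred variable is bounded by
  -- one.
  have h6 : p * (|u| * (1 - p)) ^ 3 + (1 - p) * (|u| * p) ^ 3 ≤ p * (1 - p) * |u| ^ 3 := by
    calc p * (|u| * (1 - p)) ^ 3 + (1 - p) * (|u| * p) ^ 3
        = p * (1 - p) * |u| ^ 3 * ((1 - p) ^ 2 + p ^ 2) := by ring
      _ ≤ p * (1 - p) * |u| ^ 3 * 1 := by
        gcongr
        nlinarith
      _ = _ := by ring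
  linarith

theorem charFun_map_centred_indicator {Ω : Type*} [MeasurableSpace Ω] (μ : Measure Ω)
    [IsProbabilityMeasure μ] {E : Set Ω} (hE : MeasurableSet E) (s t : ℝ) :
    charFun (μ.map fun ω => (μ.real E - E.indicator (fun _ => (1 : ℝ)) ω) / s) t
      = μ.real E * Complex.exp ((t / s * (μ.real E - 1) : ℝ) * Complex.I)
        + (1 - μ.real E) * Complex.exp ((t / s * μ.real E : ℝ) * Complex.I) := by
  have hmeas : Measurable fun ω => (μ.real E - E.indicator (fun _ => (1 : ℝ)) ω) / s :=
    (measurable_const.sub (measurable_const.indicator hE)).div_const s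
  rw [charFun_apply_real, integral_map hmeas.aemeasurable (by fun_prop)]
  set q := μ.real E with hq
  have hfun : (fun ω => Complex.exp
      (t * ((q - E.indicator (fun _ => (1 : ℝ)) ω) / s : ℝ) * Complex.I))
      = fun ω => E.indicator (fun _ => Complex.exp ((t / s * (q - 1) : ℝ) * Complex.I)) ω
        + Eᶜ.indicator (fun _ => Complex.exp ((t / s * q : ℝ) * Complex.I)) ω := by
    funext ω
    by_cases h : ω ∈ E
    · simp only [h, Set.indicator_of_mem, Set.mem_compl_iff, not_true_eq_false,
        not_false_eq_true, Set.indicator_of_notMem, add_zero]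
      congr 1; push_cast; ring
    · simp only [h, Set.indicator_of_mem, Set.mem_compl_iff,
        not_false_eq_true, Set.indicator_of_notMem, zero_add]
      congr 1; push_cast; ring
  rw [hfun, integral_add ((integrable_const _).indicator hE)
    ((integrable_const _).indicator hE.compl), integral_indicator_const _ hE,
    integral_indicator_const _ hE.compl, probReal_compl_eq_one_sub hE, ← hq]
  simp only [Complex.real_smul]
  push_cast
  rfl

theorem measurableSet_received_ne_assigned {Ω : Type*} [MeasurableSpace Ω]
    {c d : Ω → Treatment} (hc : Measurable c) (hd : Measurable d) :
    MeasurableSet {ω | d ω ≠ c ω} := by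
  have heq : {ω | d ω ≠ c ω} = (fun ω => (d ω, c ω)) ⁻¹' {x | x.1 ≠ x.2} := rfl
  have : Finite Treatment := Finite.of_surjective (fun b : Bool => if b then .A else .B)
    fun x => by cases x; exacts [⟨true, rfl⟩, ⟨false, rfl⟩]
  have : DiscreteMeasurableSpace Treatment := ⟨fun _ => trivial⟩
  rw [heq]
  exact hd.prodMk hc (Set.toFinite _).measurableSet

theorem numSame_sub_numDiff_eq {Ω : Type*} {n : ℕ} (p : Fin n → ℝ)
    (c d : Fin n → Ω → Treatment) (ω : Ω) :
    ((numSame (fun i => c i ω) (fun i => d i ω) : ℝ)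
        - (numDiff (fun i => c i ω) (fun i => d i ω) : ℝ) - switchingMean p)
      / (2 * switchingSD p)
      = ∑ i, (p i - {ω | d i ω ≠ c i ω}.indicator (fun _ => (1 : ℝ)) ω) / switchingSD p := by
  have hsame : (numSame (fun i => c i ω) (fun i => d i ω) : ℝ)
      = n - ∑ i, {ω | d i ω ≠ c i ω}.indicator (fun _ => (1 : ℝ)) ω := by
    rw [eq_sub_iff_add_eq, numSame, Nat.cast_sum, ← Finset.sum_add_distrib]
    trans ∑ _i : Fin n, (1 : ℝ)
    · refine Finset.sum_congr rfl fun i _ => ?_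
      by_cases h : c i ω = d i ω
      · simp [h]
      · simp [h, Ne.symm h]
    · simp
  -- Only the factor `2` is cancelled, so the identity also holds when `switchingSD p = 0`.
  rw [numDiff, Nat.cast_sub (numSame_le _ _), hsame, ← Finset.sum_div, Finset.sum_sub_distrib,
    switchingMean, ← mul_div_mul_left (∑ i, p i - _) (switchingSD p) two_ne_zero]
  congr 1
  ring

namespace IsBernoulliSwitching

variable {Ω : Type*} [MeasurableSpace Ω] {μ : Measure Ω} {n : ℕ} {p : Fin n → ℝ}
  {c d : Fin n → Ω → Treatment}

theorem measurableSet_switch (h : IsBernoulliSwitching μ p c d) (i : Fin n) :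
    MeasurableSet {ω | d i ω ≠ c i ω} :=
  measurableSet_received_ne_assigned (h.measurable_assigned i) (h.measurable_received i)

theorem measurable_centred (h : IsBernoulliSwitching μ p c d) (i : Fin n) :
    Measurable fun ω =>
      (p i - {ω | d i ω ≠ c i ω}.indicator (fun _ => (1 : ℝ)) ω) / switchingSD p :=
  (measurable_const.sub (measurable_const.indicator (h.measurableSet_switch i))).div_const _

theorem norm_charFun_sub_exp_le [IsProbabilityMeasure μ] (h : IsBernoulliSwitching μ p c d)
    {t : ℝ} (hpos : 0 < switchingSD p) (ht : |t| ≤ switchingSD p) :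
    ‖charFun (μ.map fun ω =>
        ∑ i, (p i - {ω | d i ω ≠ c i ω}.indicator (fun _ => (1 : ℝ)) ω) / switchingSD p) t
      - Complex.exp ((-(t ^ 2 / 2) : ℝ))‖ ≤ 2 * |t| ^ 3 / switchingSD p := by
  set s := switchingSD p with hs
  have hp0 i : 0 ≤ p i := h.prob i ▸ measureReal_nonneg
  have hp1 i : p i ≤ 1 := h.prob i ▸ measureReal_le_one
  have hs2 : ∑ i, p i * (1 - p i) = s ^ 2 := by
    rw [hs, switchingSD, Real.sq_sqrt]
    exact Finset.sum_nonneg fun i _ => mul_nonneg (hp0 i) (by linarith [hp1 i])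
  have hindep : iIndepFun (fun i ω =>
      (p i - {ω | d i ω ≠ c i ω}.indicator (fun _ => (1 : ℝ)) ω) / s) μ :=
    (h.indep.iIndepFun_indicator (β := ℝ)).comp (fun i x => (p i - x) / s)
      fun i => by fun_prop
  rw [hindep.charFun_map_fun_sum_eq_prod fun i => (h.measurable_centred i).aemeasurable,
    Finset.prod_apply]
  -- Split the Gaussian into one factor per actor, according to its share of the variance.
  have hexp : Complex.exp ((-(t ^ 2 / 2) : ℝ))
      = ∏ i, Complex.exp ((-(p i * (1 - p i) * (t / s) ^ 2 / 2) : ℝ)) := by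
    rw [← Complex.exp_sum, ← Complex.ofReal_sum, Finset.sum_neg_distrib, ← Finset.sum_div,
      ← Finset.sum_mul, hs2, ← mul_pow, mul_div_cancel₀ _ hpos.ne']
  rw [hexp]
  refine (norm_prod_sub_prod_le_sum_norm_sub _ _ _ ?_ ?_).trans ?_
  · intro i _
    have := Measure.isProbabilityMeasure_map (μ := μ) (h.measurable_centred i).aemeasurable
    exact norm_charFun_le_one t
  · intro i _
    rw [Complex.norm_exp, Complex.ofReal_re, Real.exp_le_one_iff]
    have := mul_nonneg (mul_nonneg (hp0 i) (sub_nonneg.2 (hp1 i))) (sq_nonneg (t / s))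
    linarith
  · have hu : |t / s| ≤ 1 := by
      rw [abs_div, abs_of_pos hpos]
      exact (div_le_one hpos).2 ht
    calc _ ≤ ∑ i, 2 * (p i * (1 - p i)) * |t / s| ^ 3 := by
          refine Finset.sum_le_sum fun i _ => ?_
          have hchar := charFun_map_centred_indicator μ (h.measurableSet_switch i) s t
          rw [h.prob i] at hchar
          rw [hchar]
          exact norm_bernoulli_charFun_sub_exp_le (hp0 i) (hp1 i) hu
      _ = 2 * |t| ^ 3 / s := by
          rw [← Finset.sum_mul, ← Finset.mul_sum, hs2, abs_div, abs_of_pos hpos]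
          field_simp

end IsBernoulliSwitching

theorem theorem3 {Ω : ℕ → Type*} [∀ n, MeasurableSpace (Ω n)]
    (μ : (n : ℕ) → Measure (Ω n)) [∀ n, IsProbabilityMeasure (μ n)]
    (p : (n : ℕ) → Fin n → ℝ) (c d : (n : ℕ) → Fin n → Ω n → Treatment)
    (hswitch : ∀ n, IsBernoulliSwitching (μ n) (p n) (c n) (d n))
    (hs : Tendsto (fun n => switchingSD (p n)) atTop atTop) :
    TendstoInDistribution
      (fun n ω => ((numSame (fun i => c n i ω) (fun i => d n i ω) : ℝ)
          - (numDiff (fun i => c n i ω) (fun i => d n i ω) : ℝ) - switchingMean (p n))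
        / (2 * switchingSD (p n)))
      atTop (id : ℝ → ℝ) μ (gaussianReal 0 1) := by
  simp_rw [numSame_sub_numDiff_eq]
  refine ⟨fun n => (Finset.measurable_sum _ fun i _ =>
    (hswitch n).measurable_centred i).aemeasurable, aemeasurable_id, ?_⟩
  refine ProbabilityMeasure.tendsto_iff_tendsto_charFun.2 fun t => ?_
  have hgauss : charFun ((gaussianReal 0 1).map (id : ℝ → ℝ)) t
      = Complex.exp ((-(t ^ 2 / 2) : ℝ)) := by
    rw [Measure.map_id, charFun_gaussianReal]
    congr 1
    push_cast
    ring
  simp only [ProbabilityMeasure.coe_mk]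
  rw [hgauss, tendsto_iff_norm_sub_tendsto_zero]
  refine squeeze_zero' (Eventually.of_forall fun _ => norm_nonneg _) ?_
    (hs.const_div_atTop (2 * |t| ^ 3))
  -- For fixed `t`, divergence of `s_n` eventually gives `|t / s_n| ≤ 1`, the range of the Taylor
  -- estimates.
  filter_upwards [hs.eventually_gt_atTop 0, hs.eventually_ge_atTop |t|] with n hpos ht
  exact (hswitch n).norm_charFun_sub_exp_le hpos ht
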